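/- Let $p>3$ be a prime, let $\mathbb Z_p$ denote the set of rational numbers whose denominator (in lowest terms) is not divisible by $p$, and for $a,b\in\mathbb Z_p$ write $a\equiv b \pmod p$ if $a-b=pc$ for some $c\in\mathbb Z_p$. Then, with $[x]$ denoting the greatest integer not exceeding $x$, the sum $\sum_{k=1}^{[p/3]}\binom{3k}{k}\frac1{9^k}$ lies in $\mathbb Z_p$ and $$\sum_{k=1}^{[p/3]}\binom{3k}{k}\frac{1}{9^k}\equiv\begin{cases}0 \pmod p&\text{if } p\equiv\pm1,\pm2\pmod 9,\\ -3\pmod p&\text{if } p\equiv\pm4\pmod 9.\end{cases}$$ -/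

import Mathlib

/-- The set of rational `p`-integers: the rational numbers whose denominator (in lowest
terms) is not divisible by `p`. -/
def pIntegers (p : ℕ) : Set ℚ := {r : ℚ | ¬ p ∣ r.den}

/-- Congruence modulo `p` of rational `p`-integers: both numbers are `p`-integers and
their difference is `p` times a `p`-integer. -/
def RatModEq (p : ℕ) (a b : ℚ) : Prop :=
  a ∈ pIntegers p ∧ b ∈ pIntegers p ∧ ∃ c ∈ pIntegers p, a - b = (p : ℚ) * c

open Finset

/-! Put n = [p/3]. Modulo p, n is -1/3 or -2/3, and then C(3k,k) ≡ C(n+k,2k)(-27)^k for k ≤ n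
(`choose_three_mul_zmod_eq`). Dividing by 9^k turns the sum into `evenChooseSum (-3) n - 1`, and
Pascal's rule makes the even sums at -3 periodic in n with values 1, -2, 1
(`evenChooseSum_neg_three`). -/

/-- The even-index sums `∑ₖ C(n+k, 2k) zᵏ`. -/
def evenChooseSum (z : ℤ) (n : ℕ) : ℤ :=
  ∑ k ∈ range (n + 1), ((n + k).choose (2 * k) : ℤ) * z ^ k

/-- The odd-index sums `∑ₖ C(n+k+1, 2k+1) zᵏ`. -/
def oddChooseSum (z : ℤ) (n : ℕ) : ℤ :=
  ∑ k ∈ range (n + 1), ((n + k + 1).choose (2 * k + 1) : ℤ) * z ^ k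

theorem evenChooseSum_succ (z : ℤ) (n : ℕ) :
    evenChooseSum z (n + 1) = evenChooseSum z n + z * oddChooseSum z n := by
  have hS : evenChooseSum z n
      = 1 + ∑ k ∈ range (n + 1), ((n + k + 1).choose (2 * k + 2) : ℤ) * z ^ (k + 1) := by
    rw [sum_range_succ, Nat.choose_eq_zero_of_lt (by omega : n + n + 1 < 2 * n + 2)]
    unfold evenChooseSum
    rw [sum_range_succ']
    simp only [mul_add, mul_one, ← add_assoc]
    simp [add_comm]
  rw [hS]
  unfold evenChooseSum oddChooseSum
  rw [sum_range_succ', mul_sum, add_assoc (1 : ℤ), ← sum_add_distrib, add_comm (1 : ℤ)]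
  congr 1
  · refine sum_congr rfl fun k _ => ?_
    rw [show n + 1 + (k + 1) = (n + k + 1) + 1 by ring, show 2 * (k + 1) = (2 * k + 1) + 1 by ring,
      Nat.choose_succ_succ]
    push_cast
    ring
  · simp

theorem oddChooseSum_succ (z : ℤ) (n : ℕ) :
    oddChooseSum z (n + 1) = oddChooseSum z n + evenChooseSum z (n + 1) := by
  have hT : oddChooseSum z n
      = ∑ k ∈ range (n + 1 + 1), ((n + k + 1).choose (2 * k + 1) : ℤ) * z ^ k := by
    rw [sum_range_succ, Nat.choose_eq_zero_of_lt (by omega : n + (n + 1) + 1 < 2 * (n + 1) + 1)]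
    simp [oddChooseSum]
  rw [hT]
  unfold evenChooseSum oddChooseSum
  rw [← sum_add_distrib]
  refine sum_congr rfl fun k _ => ?_
  rw [show n + 1 + k + 1 = (n + k + 1) + 1 by ring, Nat.choose_succ_succ,
    show n + 1 + k = n + k + 1 by ring]
  push_cast
  ring

/-- The recurrences act on (even, odd) by a matrix of determinant 1 and trace z + 2. At z = -3 its
characteristic polynomial is x² + x + 1, so its cube is the identity. -/
theorem evenChooseSum_neg_three_aux (m : ℕ) :
    evenChooseSum (-3) (3 * m) = 1 ∧ oddChooseSum (-3) (3 * m) = 1 ∧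
    evenChooseSum (-3) (3 * m + 1) = -2 ∧ evenChooseSum (-3) (3 * m + 2) = 1 := by
  induction m with
  | zero => decide
  | succ m ih =>
    obtain ⟨h0, h1, -, -⟩ := ih
    have e1 := evenChooseSum_succ (-3) (3 * m)
    have o1 := oddChooseSum_succ (-3) (3 * m)
    have e2 := evenChooseSum_succ (-3) (3 * m + 1)
    have o2 := oddChooseSum_succ (-3) (3 * m + 1)
    have e3 := evenChooseSum_succ (-3) (3 * m + 2)
    have o3 := oddChooseSum_succ (-3) (3 * m + 2)
    have e4 := evenChooseSum_succ (-3) (3 * m + 3)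
    have o4 := oddChooseSum_succ (-3) (3 * m + 3)
    have e5 := evenChooseSum_succ (-3) (3 * m + 4)
    rw [show 3 * (m + 1) = 3 * m + 3 by ring]
    refine ⟨?_, ?_, ?_, ?_⟩ <;> linarith

theorem evenChooseSum_neg_three (n : ℕ) :
    evenChooseSum (-3) n = if n % 3 = 1 then -2 else 1 := by
  obtain ⟨h0, -, h1, h2⟩ := evenChooseSum_neg_three_aux (n / 3)
  have hn := Nat.div_add_mod n 3
  have hlt := Nat.mod_lt n (by norm_num : 3 > 0)
  generalize n / 3 = q at *
  interval_cases h : n % 3 <;> subst hn <;> simpa using by assumption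

theorem choose_three_mul_mul_factorial_succ (k : ℕ) :
    (3 * (k + 1)).choose (k + 1) * (2 * (k + 1)).factorial =
      (3 * k).choose k * (2 * k).factorial * (3 * (3 * k + 1) * (3 * k + 2)) := by
  have h1 := Nat.choose_mul_factorial_mul_factorial (by omega : k ≤ 3 * k)
  have h2 := Nat.choose_mul_factorial_mul_factorial (by omega : k + 1 ≤ 3 * (k + 1))
  rw [show 3 * k - k = 2 * k by omega] at h1
  rw [show 3 * (k + 1) - (k + 1) = 2 * (k + 1) by omega,
    show (3 * (k + 1)).factorial = (3 * k + 3) * ((3 * k + 2) * ((3 * k + 1) * (3 * k).factorial))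
      from rfl, ← h1, Nat.factorial_succ k] at h2
  have hk : 0 < (k + 1) * k.factorial := by positivity
  refine Nat.eq_of_mul_eq_mul_left hk ?_
  linear_combination h2

theorem choose_add_two_mul_mul_factorial_succ {n k : ℕ} (hk : k < n) :
    (n + (k + 1)).choose (2 * (k + 1)) * (2 * (k + 1)).factorial =
      (n + k).choose (2 * k) * (2 * k).factorial * ((n + k + 1) * (n - k)) := by
  obtain ⟨d, rfl⟩ := Nat.exists_eq_add_of_lt hk
  have h1 := Nat.choose_mul_factorial_mul_factorial (by omega : 2 * k ≤ k + d + 1 + k)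
  have h2 := Nat.choose_mul_factorial_mul_factorial
    (by omega : 2 * (k + 1) ≤ k + d + 1 + (k + 1))
  rw [show k + d + 1 + k - 2 * k = d + 1 by omega] at h1
  rw [show k + d + 1 + (k + 1) - 2 * (k + 1) = d by omega,
    show k + d + 1 + (k + 1) = k + d + 1 + k + 1 by omega,
    Nat.factorial_succ (k + d + 1 + k), ← h1, Nat.factorial_succ d] at h2
  rw [show k + d + 1 - k = d + 1 by omega]
  refine Nat.eq_of_mul_eq_mul_left d.factorial_pos ?_
  rw [show k + d + 1 + (k + 1) = k + d + 1 + k + 1 by omega]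
  linear_combination h2

/-- If `n ≡ -1/3` or `n ≡ -2/3`, then `C(3k, k) ≡ C(n+k, 2k) (-27)ᵏ` up to a factor `(2k)!`. -/
theorem choose_three_mul_mul_factorial_eq {R : Type*} [CommRing R] {n : ℕ}
    (h : (3 * n + 1 : R) * (3 * n + 2) = 0) {k : ℕ} (hk : k ≤ n) :
    ((3 * k).choose k : R) * (2 * k).factorial =
      (n + k).choose (2 * k) * (2 * k).factorial * (-27) ^ k := by
  induction k with
  | zero => simp
  | succ k ih =>
    have ih := ih (by omega)
    have h1 := congrArg (Nat.cast : ℕ → R) (choose_three_mul_mul_factorial_succ k)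
    have h2 := congrArg (Nat.cast : ℕ → R) (choose_add_two_mul_mul_factorial_succ hk)
    have hc : ((n - k : ℕ) : R) = n - k := Nat.cast_sub (by omega)
    simp only [Nat.cast_mul, hc] at h1 h2
    rw [h1, h2, ih]
    push_cast
    -- The step ratios match because 3(3k+1)(3k+2) + 27(n+k+1)(n-k) = 3(3n+1)(3n+2), independent of
    -- k.
    linear_combination
      3 * ((n + k).choose (2 * k) : R) * (2 * k).factorial * (-27) ^ k * h

theorem choose_three_mul_zmod_eq {p : ℕ} [Fact p.Prime] (hp3 : 3 < p) {k : ℕ} (hk : k ≤ p / 3) :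
    ((3 * k).choose k : ZMod p) = (p / 3 + k).choose (2 * k) * (-27) ^ k := by
  have hp : p.Prime := Fact.out
  have h : (3 * (p / 3 : ℕ) + 1 : ZMod p) * (3 * (p / 3 : ℕ) + 2) = 0 := by
    have h3 : ¬ 3 ∣ p := fun hd => by
      have := (Nat.prime_dvd_prime_iff_eq Nat.prime_three hp).1 hd
      omega
    have hc : 3 * (p / 3) + 1 = p ∨ 3 * (p / 3) + 2 = p := by omega
    rcases hc with hc | hc <;> have := congrArg (Nat.cast : ℕ → ZMod p) hc <;>
      push_cast at this <;> rw [this] <;> simp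
  -- Since 2k ≤ 2p/3 < p, the factor (2k)! can be cancelled.
  have hf : ((2 * k).factorial : ZMod p) ≠ 0 := by
    rw [Ne, ZMod.natCast_eq_zero_iff, hp.dvd_factorial]
    omega
  refine mul_right_cancel₀ hf ?_
  rw [choose_three_mul_mul_factorial_eq h hk]
  ring

/-- Multiplying by 9^[p/3] clears denominators, so the congruence can be checked in `ZMod p`; the -1
removes the k = 0 term. -/
theorem sum_choose_three_mul_zmod_eq {p : ℕ} [Fact p.Prime] (hp3 : 3 < p) :
    ∑ k ∈ Icc 1 (p / 3), ((3 * k).choose k : ZMod p) * 9 ^ (p / 3 - k) =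
      9 ^ (p / 3) * ((evenChooseSum (-3) (p / 3) - 1 : ℤ) : ZMod p) := by
  have h : evenChooseSum (-3) (p / 3) - 1
      = ∑ k ∈ Icc 1 (p / 3), ((p / 3 + k).choose (2 * k) : ℤ) * (-3) ^ k := by
    rw [evenChooseSum, range_eq_Ico, sum_eq_sum_Ico_succ_bot (by omega)]
    simp only [mul_zero, Nat.choose_zero_right, pow_zero, Nat.cast_one, mul_one,
      add_sub_cancel_left, zero_add]
    rfl
  rw [h, Int.cast_sum, mul_sum]
  refine sum_congr rfl fun k hk => ?_
  have hk := (mem_Icc.1 hk).2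
  rw [choose_three_mul_zmod_eq hp3 hk]
  obtain ⟨d, hd⟩ := Nat.exists_eq_add_of_le hk
  rw [show (9 : ZMod p) ^ (p / 3) = 9 ^ k * 9 ^ (p / 3 - k) by rw [← pow_add]; congr 1; omega,
    show (-27 : ZMod p) = 9 * (-3) by norm_num, mul_pow]
  push_cast
  ring

theorem intCast_div_pow_mem_pIntegers {p b : ℕ} (hp : p.Prime) (hb : ¬ p ∣ b) (a : ℤ) (n : ℕ) :
    (a : ℚ) / (b : ℚ) ^ n ∈ pIntegers p := by
  intro hd
  have h := Rat.den_dvd a ((b : ℤ) ^ n)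
  exact hb (hp.dvd_of_dvd_pow (Int.natCast_dvd_natCast.1
    ((Int.natCast_dvd_natCast.2 hd).trans (by exact_mod_cast h))))

theorem ratModEq_sum_choose_three_mul {p : ℕ} (hp : p.Prime) (hp3 : 3 < p) :
    RatModEq p (∑ k ∈ Icc 1 (p / 3), (Nat.choose (3 * k) k : ℚ) / 9 ^ k)
      ((evenChooseSum (-3) (p / 3) - 1 : ℤ) : ℚ) := by
  have := Fact.mk hp
  set c := evenChooseSum (-3) (p / 3) - 1 with hc
  set A : ℤ := ∑ k ∈ Icc 1 (p / 3), ((3 * k).choose k : ℤ) * 9 ^ (p / 3 - k) with hA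
  have h9 : ¬ p ∣ 9 := fun hd => by
    have := Nat.le_of_dvd three_pos (hp.dvd_of_dvd_pow (show p ∣ 3 ^ 2 from hd))
    omega
  have hsum : ∑ k ∈ Icc 1 (p / 3), (Nat.choose (3 * k) k : ℚ) / 9 ^ k
      = (A : ℚ) / ((9 : ℕ) : ℚ) ^ (p / 3) := by
    rw [hA, Int.cast_sum, sum_div]
    refine sum_congr rfl fun k hk => ?_
    have hk := (mem_Icc.1 hk).2
    push_cast
    rw [div_eq_div_iff (by positivity) (by positivity), mul_assoc, ← pow_add,
      Nat.sub_add_cancel hk]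
  have hdvd : (p : ℤ) ∣ A - 9 ^ (p / 3) * c := by
    rw [← ZMod.intCast_zmod_eq_zero_iff_dvd, hA, hc]
    have := sum_choose_three_mul_zmod_eq hp3
    push_cast at this ⊢
    rw [this, sub_self]
  obtain ⟨m, hm⟩ := hdvd
  rw [hsum]
  refine ⟨intCast_div_pow_mem_pIntegers hp h9 A _, ?_, _,
    intCast_div_pow_mem_pIntegers hp h9 m (p / 3), ?_⟩
  · simpa using intCast_div_pow_mem_pIntegers hp h9 c 0
  · have hm' : (A : ℚ) - 9 ^ (p / 3) * c = p * m := by exact_mod_cast hm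
    push_cast
    field_simp
    linear_combination hm'

theorem corollary2p11 (p : ℕ) (hp : p.Prime) (hp3 : 3 < p) :
    (((p : ℤ) ≡ 1 [ZMOD 9] ∨ (p : ℤ) ≡ -1 [ZMOD 9] ∨
        (p : ℤ) ≡ 2 [ZMOD 9] ∨ (p : ℤ) ≡ -2 [ZMOD 9]) →
      RatModEq p (∑ k ∈ Finset.Icc 1 (p / 3), (Nat.choose (3 * k) k : ℚ) / 9 ^ k) 0) ∧
    (((p : ℤ) ≡ 4 [ZMOD 9] ∨ (p : ℤ) ≡ -4 [ZMOD 9]) →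
      RatModEq p (∑ k ∈ Finset.Icc 1 (p / 3), (Nat.choose (3 * k) k : ℚ) / 9 ^ k) (-3)) := by
  have h := ratModEq_sum_choose_three_mul hp hp3
  rw [evenChooseSum_neg_three] at h
  unfold Int.ModEq
  constructor <;> intro hmod
  -- [p/3] ≡ 1 mod 3 means p mod 9 is 3, 4 or 5, so the residues ±1, ±2 avoid it and ±4 hit it.
  · rw [if_neg (by omega)] at h
    simpa using h
  · rw [if_pos (by omega)] at h
    norm_num at h
    exact h
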